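/- A Pisot number is a real algebraic integer $\beta>1$ all of whose other Galois conjugates have modulus less than $1$. Let $\beta$ be a Pisot number, let $T_\beta x=\beta x \bmod 1$, and let $\mu$ be a nonzero finite Borel measure on $[0,1]$ that is $T_\beta$-invariant. Suppose that $\mu$ is a frame spectral measure with spectrum $\Lambda\subset\mathbb{R}$, that is, there are constants $A,B>0$ with $$A\|f\|_{L^2(\mu)}^2\le\sum_{\lambda\in\Lambda}\Big|\int f(x)e^{-2\pi i\lambda x}\,d\mu(x)\Big|^2\le B\|f\|_{L^2(\mu)}^2\qquad\text{for all } f\in L^2(\mu).$$ Let $$\dim\Lambda=\sup\Big\{r>0:\ \limsup_{h\to\infty}\ \sup_{x\in\mathbb{R}}\frac{\#(\Lambda\cap B(x,h))}{h^r}>0\Big\}$$ (with $\sup\emptyset=0$) be the Beurling dimension of $\Lambda$, and call $\mu$ exact dimensional with $\dim\mu=\delta$ if the local dimension $d_\mu(x)=\lim_{r\to0}\frac{\log\mu(B(x,r))}{\log r}$ exists and equals $\delta$ for $\mu$-almost every $x$. Then: 1. for $\mu$-almost every $x$ the local dimension $d_\mu(x)$ exists (as a finite number) and $\dim\Lambda\le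 d_\mu(x)$; 2. in particular, whenever $\mu$ is exact dimensional, $\dim\Lambda\le\dim\mu$; 3. if $\mu$ is moreover ergodic for $T_\beta$, then $\mu$ is exact dimensional and $\dim\Lambda\le\dim\mu$. -/

import Mathlib

open Filter Topology MeasureTheory
open scoped NNReal ENNReal

/-- A Pisot number: a real algebraic integer `β > 1` all of whose other Galois conjugates
have modulus less than one. (The integers `β ≥ 2` are Pisot numbers.) -/
def IsPisot (β : ℝ) : Prop :=
  1 < β ∧ IsIntegral ℤ β ∧
    ∀ z : ℂ, Polynomial.aeval z (minpoly ℚ β) = 0 → z ≠ (β : ℂ) → ‖z‖ < 1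

/-- Multiplication by `β` modulo one. -/
noncomputable def betaMap (β : ℝ) (x : ℝ) : ℝ := Int.fract (β * x)

/-- A family `v` in an inner product space is a frame if
`A ‖f‖² ≤ ∑ |⟨f, v i⟩|² ≤ B ‖f‖²` for all `f`, with constants `A, B > 0`. -/
def IsFrame (𝕜 : Type*) [RCLike 𝕜] {H : Type*} [NormedAddCommGroup H] [InnerProductSpace 𝕜 H]
    {ι : Type*} (v : ι → H) : Prop :=
  ∃ A B : ℝ, 0 < A ∧ 0 < B ∧ ∀ f : H,
    Summable (fun i => ‖inner 𝕜 (v i) f‖ ^ 2) ∧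
    A * ‖f‖ ^ 2 ≤ ∑' i, ‖inner 𝕜 (v i) f‖ ^ 2 ∧
    ∑' i, ‖inner 𝕜 (v i) f‖ ^ 2 ≤ B * ‖f‖ ^ 2

/-- The character `x ↦ exp (2 π i l x)` of the real line. -/
noncomputable def expChar (l x : ℝ) : ℂ := Complex.exp (2 * Real.pi * Complex.I * l * x)

theorem memLp_expChar (μ : Measure ℝ) [IsFiniteMeasure μ] (l : ℝ) :
    MemLp (expChar l) 2 μ := by
  have hc : Continuous (expChar l) := by
    unfold expChar
    fun_prop
  refine MemLp.of_bound hc.aestronglyMeasurable 1 (Eventually.of_forall fun x => ?_)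
  have h : (2 * Real.pi * Complex.I * l * x : ℂ)
      = ((2 * Real.pi * l * x : ℝ) : ℂ) * Complex.I := by
    push_cast
    ring
  simp only [expChar]
  rw [h, Complex.norm_exp_ofReal_mul_I]

/-- `Λ` is a frame spectrum of `μ`: the exponentials with frequencies in `Λ`, indexed by `Λ`,
form a frame of `L²(μ)`. -/
def IsFrameSpectrum (μ : Measure ℝ) [IsFiniteMeasure μ] (Λ : Set ℝ) : Prop :=
  IsFrame ℂ (fun l : Λ => (memLp_expChar μ (l : ℝ)).toLp (expChar (l : ℝ)))

/-- The upper `r`-Beurling density of a set of real numbers. -/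
noncomputable def beurlingDensity (r : ℝ≥0) (Λ : Set ℝ) : ℝ≥0∞ :=
  limsup (fun h : ℝ =>
    ⨆ x : ℝ, ((Λ ∩ Metric.ball x h).encard : ℝ≥0∞) / ENNReal.ofReal h ^ (r : ℝ)) atTop

/-- The (upper) Beurling dimension: the supremum of all `r > 0` with positive upper
`r`-Beurling density (zero if there is no such `r`). -/
noncomputable def beurlingDim (Λ : Set ℝ) : ℝ≥0∞ :=
  ⨆ (r : ℝ≥0) (_ : 0 < r) (_ : 0 < beurlingDensity r Λ), (r : ℝ≥0∞)

/-- The local dimension of `μ` at `x` exists and equals `δ`. -/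
def HasLocalDim (μ : Measure ℝ) (x δ : ℝ) : Prop :=
  Tendsto (fun r : ℝ => Real.log (μ.real (Metric.ball x r)) / Real.log r) (𝓝[>] 0) (𝓝 δ)

/-- `μ` is exact dimensional with dimension `δ`: its local dimension exists and equals `δ` at
`μ`-almost every point. -/
def IsExactDimensional (μ : Measure ℝ) (δ : ℝ) : Prop :=
  ∀ᵐ x ∂μ, HasLocalDim μ x δ

/-!
Both the existence of the local dimension and its comparison with the Beurling dimension are proved
with balls, without coding by beta expansions.

*The local dimension exists.* Write `m n x` for the mass of the closed ball of radius `2 / β ^ n`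
around `x` and `T = betaMap β`. The gains `log (m n (T x)) - log (m (n + 1) x)` (`ballLogGain`)
telescope along the orbit of `x`, so that `-log (m n x)` is, up to a constant, a sum of the gains of
index `n - 1 - k` at `T^[k] x` (`neg_ballLog_eq`). On a branch `A` of `T`, which is affine with slope
`β`, the ball around `x` corresponds to the ball around `T x`; hence the gain converges almost
everywhere to minus the logarithm of the density of the push-forward of `μ.restrict A` with respect
to `μ`, by Besicovitch's differentiation theorem (`ae_exists_tendsto_ballLogGain`). A Besicovitch
covering argument shows that the supremum of the absolute values of the gains has an exponential
tail (`exists_ballLogGain_tail`) and so is integrable. Such sums, divided by `n`, converge almost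
everywhere by Breiman's version of Birkhoff's theorem (`ae_exists_tendsto_breiman_average`). This
is the proof of the Shannon-McMillan-Breiman theorem with balls in place of cylinders, and the limit
divided by `log β` is the local dimension. It is an invariant function, hence constant in the ergodic
case.

*The Beurling dimension is at most the local dimension.* The frame inequality, tested on the
indicator of a ball of radius `1 / (8 h)` around `x` modulated by a frequency `t`, shows that
`Λ ∩ ball t h` has at most a constant over the mass of that ball elements, uniformly in `t`
(`exists_encard_le_of_isFrameSpectrum`). If the local dimension at `x` is `δ`, this is
`O(h ^ s)` for every `s > δ`.
-/

/-! ### Pointwise ergodic theorems -/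

section Ergodic

variable {α : Type*} {T : α → α}

/-- `partialMax T h n x` is the maximum of `0` and the first `n` Birkhoff sums of `h` at `x`. -/
noncomputable def partialMax (T : α → α) (h : α → ℝ) : ℕ → α → ℝ
  | 0 => fun _ => 0
  | n + 1 => fun x => max 0 (h x + partialMax T h n (T x))

theorem partialMax_nonneg (h : α → ℝ) (n : ℕ) (x : α) : 0 ≤ partialMax T h n x := by
  cases n <;> simp [partialMax]

theorem partialMax_le_succ (h : α → ℝ) (n : ℕ) (x : α) :
    partialMax T h n x ≤ partialMax T h (n + 1) x := by
  induction n generalizing x with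
  | zero => exact partialMax_nonneg h 1 x
  | succ n ih => exact max_le_max le_rfl (by gcongr; exact ih _)

theorem birkhoffSum_le_partialMax (h : α → ℝ) (n : ℕ) (x : α) :
    birkhoffSum T h n x ≤ partialMax T h n x := by
  induction n generalizing x with
  | zero => simp [partialMax]
  | succ n ih =>
    rw [birkhoffSum_succ']
    exact le_max_of_le_right (by gcongr; exact ih _)

/-- The points whose Birkhoff sums for `h` are unbounded above. Unlike the set where the upper
limit of the averages is positive, this set is visibly invariant. -/
def unboundedSums (T : α → α) (h : α → ℝ) : Set α :=
  {x | ¬ BddAbove (Set.range fun n => birkhoffSum T h n x)}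

theorem preimage_unboundedSums (h : α → ℝ) :
    T ⁻¹' unboundedSums T h = unboundedSums T h := by
  ext x
  simp only [unboundedSums, Set.mem_preimage, Set.mem_ofPred_eq, not_iff_not]
  constructor
  · rintro ⟨K, hK⟩
    refine ⟨max 0 (h x + K), ?_⟩
    rintro _ ⟨n, rfl⟩
    rcases n with _ | n
    · simp
    · dsimp only
      rw [birkhoffSum_succ']
      exact le_max_of_le_right (by gcongr; exact hK ⟨n, rfl⟩)
  · rintro ⟨K, hK⟩
    refine ⟨K - h x, ?_⟩
    rintro _ ⟨n, rfl⟩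
    have := hK ⟨n + 1, rfl⟩
    dsimp only at this ⊢
    rw [birkhoffSum_succ'] at this
    linarith

theorem exists_birkhoffSum_pos_of_mem_unboundedSums {h : α → ℝ} {x : α}
    (hx : x ∈ unboundedSums T h) : ∃ n, 0 < birkhoffSum T h n x := by
  by_contra! hc
  exact hx ⟨0, by rintro _ ⟨n, rfl⟩; exact hc n⟩

theorem birkhoffSum_sub_const (f : α → ℝ) (b : ℝ) (n : ℕ) (x : α) :
    birkhoffSum T (fun y => f y - b) n x = birkhoffSum T f n x - n * b := by
  simp [birkhoffSum, Finset.sum_sub_distrib]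

/-- If `x` is not in `unboundedSums T (f - b)` then the averages are eventually below any `c > b`. -/
theorem eventually_birkhoffSum_le {f : α → ℝ} {b c : ℝ} (hbc : b < c) {x : α}
    (hx : x ∉ unboundedSums T fun y => f y - b) :
    ∀ᶠ n : ℕ in atTop, birkhoffSum T f n x / n ≤ c := by
  obtain ⟨K, hK⟩ := not_not.mp hx
  obtain ⟨N, hN⟩ := exists_nat_gt (K / (c - b))
  filter_upwards [eventually_ge_atTop (max N 1)] with n hn
  have hn1 : (1 : ℝ) ≤ n := by exact_mod_cast (le_max_right _ _).trans hn
  have hnN : (N : ℝ) ≤ n := by exact_mod_cast (le_max_left _ _).trans hn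
  have h := hK ⟨n, rfl⟩
  dsimp only at h
  rw [birkhoffSum_sub_const] at h
  rw [div_lt_iff₀ (by linarith)] at hN
  rw [div_le_iff₀ (by linarith)]
  nlinarith

variable [MeasurableSpace α] {μ : Measure α}

theorem integrable_partialMax (hT : MeasurePreserving T μ μ) {h : α → ℝ}
    (hh : Integrable h μ) (n : ℕ) : Integrable (partialMax T h n) μ := by
  induction n with
  | zero => exact integrable_zero _ _ _
  | succ n ih => exact (integrable_zero _ _ _).sup (hh.add (hT.integrable_comp_of_integrable ih))

/-- The maximal ergodic theorem, in the case where almost every orbit has a positive Birkhoff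
sum. It rests on the pointwise bound `1_{M > 0} h ≥ M - M ∘ T` for `M = partialMax T h (n + 1)`. -/
theorem integral_nonneg_of_exists_birkhoffSum_pos (hT : MeasurePreserving T μ μ) {h : α → ℝ}
    (hh : Integrable h μ) (hmh : Measurable h)
    (hpos : ∀ᵐ x ∂μ, ∃ n, 0 < birkhoffSum T h n x) :
    0 ≤ ∫ x, h x ∂μ := by
  have hmeas : ∀ n, Measurable (partialMax T h n) := by
    intro n
    induction n with
    | zero => exact measurable_const
    | succ n ih => exact measurable_const.max (hmh.add (ih.comp hT.measurable))
  let s : ℕ → Set α := fun n => {x | 0 < partialMax T h (n + 1) x}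
  have hs : ∀ n, MeasurableSet (s n) := fun n => measurableSet_lt measurable_const (hmeas _)
  have hnn : ∀ n, 0 ≤ ∫ x, (s n).indicator h x ∂μ := by
    intro n
    have hi := integrable_partialMax hT hh (n + 1)
    have h1 : ∫ x, (partialMax T h (n + 1) x - partialMax T h (n + 1) (T x)) ∂μ = 0 := by
      have h2 : ∫ x, partialMax T h (n + 1) (T x) ∂μ = ∫ x, partialMax T h (n + 1) x ∂μ := by
        conv_rhs => rw [← hT.map_eq]
        exact (integral_map hT.aemeasurable (hmeas _).aestronglyMeasurable).symm
      rw [integral_sub hi (g := fun x => partialMax T h (n + 1) (T x))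
        (hT.integrable_comp_of_integrable hi), h2, sub_self]
    rw [← h1]
    refine integral_mono (hi.sub (hT.integrable_comp_of_integrable hi)) (hh.indicator (hs n)) ?_
    intro x
    by_cases hx : x ∈ s n
    · rw [Set.indicator_of_mem hx]
      have hx' : 0 < max 0 (h x + partialMax T h n (T x)) := hx
      have h2 : partialMax T h (n + 1) x = h x + partialMax T h n (T x) :=
        max_eq_right (by_contra fun hc => by
          rw [max_eq_left (not_le.mp hc).le] at hx'
          exact hx'.ne rfl)
      have h3 := partialMax_le_succ (T := T) h n (T x)
      dsimp only
      linarith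
    · rw [Set.indicator_of_notMem hx]
      have h2 : partialMax T h (n + 1) x ≤ 0 := not_lt.mp hx
      have h3 := partialMax_nonneg (T := T) h (n + 1) (T x)
      dsimp only
      linarith
  refine ge_of_tendsto' (tendsto_integral_of_dominated_convergence (fun x => |h x|)
    (fun n => (hh.indicator (hs n)).aestronglyMeasurable) hh.abs
    (fun n => Eventually.of_forall fun x => ?_) ?_) hnn
  · by_cases hx : x ∈ s n <;> simp [hx]
  · filter_upwards [hpos] with x ⟨n, hn⟩
    refine tendsto_const_nhds.congr' ?_
    filter_upwards [eventually_ge_atTop n] with m hnm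
    have hmono : Monotone fun k => partialMax T h k x :=
      monotone_nat_of_le_succ fun k => partialMax_le_succ h k x
    have : x ∈ s m :=
      (hn.trans_le (birkhoffSum_le_partialMax h n x)).trans_le (hmono (by omega : n ≤ m + 1))
    rw [Set.indicator_of_mem this]

theorem measurable_birkhoffSum (hm : Measurable T) {f : α → ℝ} (hf : Measurable f) (n : ℕ) :
    Measurable (birkhoffSum T f n) := by
  unfold birkhoffSum
  exact Finset.measurable_sum _ fun k _ => hf.comp (hm.iterate k)

/-- Maximal ergodic theorem on an invariant set. -/
theorem setIntegral_nonneg_of_exists_birkhoffSum_pos (hT : MeasurePreserving T μ μ) {h : α → ℝ}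
    (hh : Integrable h μ) (hmh : Measurable h) {E : Set α} (hE : MeasurableSet E)
    (hinv : T ⁻¹' E = E) (hpos : ∀ x ∈ E, ∃ n, 0 < birkhoffSum T h n x) :
    0 ≤ ∫ x in E, h x ∂μ := by
  have hT' : MeasurePreserving T (μ.restrict E) (μ.restrict E) := by
    have := hT.restrict_preimage hE
    rwa [hinv] at this
  exact integral_nonneg_of_exists_birkhoffSum_pos hT' hh.integrableOn hmh
    ((ae_restrict_iff' hE).mpr (Eventually.of_forall hpos))

theorem measurableSet_unboundedSums (hm : Measurable T) {h : α → ℝ} (hh : Measurable h) :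
    MeasurableSet (unboundedSums T h) :=
  (measurableSet_bddAbove_range fun n => measurable_birkhoffSum hm hh n).compl

/-- On an invariant set where the Birkhoff sums of `f - b` are unbounded above, the mean of `f` is
at least `b`. -/
theorem mul_measureReal_le_setIntegral [IsFiniteMeasure μ] (hT : MeasurePreserving T μ μ)
    {f : α → ℝ} (hf : Integrable f μ) (hmf : Measurable f) (b : ℝ) {E : Set α}
    (hE : MeasurableSet E) (hinv : T ⁻¹' E = E)
    (hsub : E ⊆ unboundedSums T fun y => f y - b) :
    b * μ.real E ≤ ∫ x in E, f x ∂μ := by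
  have h := setIntegral_nonneg_of_exists_birkhoffSum_pos hT (h := fun y => f y - b)
    (hf.sub (integrable_const b)) (hmf.sub_const b) hE hinv
    fun x hx => exists_birkhoffSum_pos_of_mem_unboundedSums (hsub hx)
  rw [integral_sub hf.integrableOn (integrable_const b).integrableOn] at h
  simp only [integral_const, measureReal_restrict_apply_univ, smul_eq_mul] at h
  linarith

/-- Almost every orbit has Birkhoff averages that are bounded above. -/
theorem ae_exists_notMem_unboundedSums [IsFiniteMeasure μ] (hT : MeasurePreserving T μ μ)
    {f : α → ℝ} (hf : Integrable f μ) (hmf : Measurable f) :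
    ∀ᵐ x ∂μ, ∃ b : ℕ, x ∉ unboundedSums T fun y => f y - b := by
  set E : Set α := ⋂ b : ℕ, unboundedSums T fun y => f y - b with hEdef
  have hE : MeasurableSet E := MeasurableSet.iInter fun b =>
    measurableSet_unboundedSums hT.measurable (hmf.sub_const _)
  have hinv : T ⁻¹' E = E := by
    simp only [hEdef, Set.preimage_iInter, preimage_unboundedSums]
  have hb : ∀ b : ℕ, (b : ℝ) * μ.real E ≤ ∫ x in E, f x ∂μ := fun b =>
    mul_measureReal_le_setIntegral hT hf hmf b hE hinv (Set.iInter_subset _ b)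
  have h0 : μ.real E = 0 := by
    by_contra hne
    have hpos : 0 < μ.real E := lt_of_le_of_ne measureReal_nonneg (Ne.symm hne)
    obtain ⟨b, hb'⟩ := exists_nat_gt ((∫ x in E, f x ∂μ) / μ.real E)
    rw [div_lt_iff₀ hpos] at hb'
    exact absurd (hb b) (not_le.mpr hb')
  have h1 : μ E = 0 := (measureReal_eq_zero_iff).mp h0
  filter_upwards [measure_eq_zero_iff_ae_notMem.mp h1] with x hx
  simpa [hEdef] using hx

/-- Almost no orbit has Birkhoff averages oscillating across the gap between `a` and `b`. -/
theorem ae_notMem_unboundedSums_or [IsFiniteMeasure μ] (hT : MeasurePreserving T μ μ)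
    {f : α → ℝ} (hf : Integrable f μ) (hmf : Measurable f) {a b : ℝ} (hab : a < b) :
    ∀ᵐ x ∂μ, x ∉ unboundedSums T (fun y => f y - b) ∨
      x ∉ unboundedSums T (fun y => -f y - (-a)) := by
  set E : Set α := unboundedSums T (fun y => f y - b) ∩ unboundedSums T (fun y => -f y - (-a))
    with hEdef
  have hE : MeasurableSet E :=
    (measurableSet_unboundedSums hT.measurable (hmf.sub_const _)).inter
      (measurableSet_unboundedSums hT.measurable (hmf.neg.sub_const _))
  have hinv : T ⁻¹' E = E := by
    rw [hEdef, Set.preimage_inter, preimage_unboundedSums, preimage_unboundedSums]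
  have h1 := mul_measureReal_le_setIntegral hT hf hmf b hE hinv Set.inter_subset_left
  have h2 := mul_measureReal_le_setIntegral hT hf.neg hmf.neg (-a) hE hinv Set.inter_subset_right
  have h3 : ∫ x in E, (-f) x ∂μ = -∫ x in E, f x ∂μ := integral_neg _
  rw [h3] at h2
  have h0 : μ.real E = 0 := by
    have := measureReal_nonneg (μ := μ) (s := E)
    nlinarith
  have h4 : μ E = 0 := (measureReal_eq_zero_iff).mp h0
  filter_upwards [measure_eq_zero_iff_ae_notMem.mp h4] with x hx
  by_contra! hc
  exact hx ⟨hc.1, hc.2⟩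

/-- Birkhoff's pointwise ergodic theorem, existence of the limit. -/
theorem ae_exists_tendsto_birkhoffSum_div [IsFiniteMeasure μ] (hT : MeasurePreserving T μ μ)
    {f : α → ℝ} (hf : Integrable f μ) (hmf : Measurable f) :
    ∀ᵐ x ∂μ, ∃ c : ℝ, Tendsto (fun n : ℕ => birkhoffSum T f n x / n) atTop (𝓝 c) := by
  have hosc : ∀ᵐ x ∂μ, ∀ a b : ℚ, (a : ℝ) < b →
      (x ∉ unboundedSums T (fun y => f y - b) ∨ x ∉ unboundedSums T (fun y => -f y - (-a))) := by
    rw [ae_all_iff]; intro a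
    rw [ae_all_iff]; intro b
    by_cases hab : (a : ℝ) < b
    · filter_upwards [ae_notMem_unboundedSums_or hT hf hmf hab] with x hx _ using hx
    · exact Eventually.of_forall fun x h => absurd h hab
  filter_upwards [hosc, ae_exists_notMem_unboundedSums hT hf hmf,
    ae_exists_notMem_unboundedSums hT hf.neg hmf.neg] with x hx ⟨B, hB⟩ ⟨A, hA⟩
  have hneg : ∀ n, birkhoffSum T (fun y => -f y) n x = -birkhoffSum T f n x := fun n => by
    simp [birkhoffSum]
  have hA' : x ∉ unboundedSums T (fun y => -f y - A) := hA
  have hup := eventually_birkhoffSum_le (lt_add_one (B : ℝ)) hB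
  have hlow := eventually_birkhoffSum_le (lt_add_one (A : ℝ)) hA'
  refine tendsto_of_no_upcrossings (s := Set.range ((↑) : ℚ → ℝ)) Rat.denseRange_cast ?_
    ?_ ?_
  · rintro _ ⟨a, rfl⟩ _ ⟨b, rfl⟩ hab ⟨h1, h2⟩
    -- two rationals inside the gap leave room on both sides
    obtain ⟨b', hab', hb'⟩ := exists_rat_btwn hab
    obtain ⟨a', haa', ha'⟩ := exists_rat_btwn hab'
    rcases hx a' b' ha' with h | h
    · obtain ⟨n, hn1, hn2⟩ := (h2.and_eventually (eventually_birkhoffSum_le hb' h)).exists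
      exact absurd hn1 (not_lt.mpr hn2)
    · obtain ⟨n, hn1, hn2⟩ := (h1.and_eventually
        (eventually_birkhoffSum_le (neg_lt_neg haa') h)).exists
      rw [hneg, neg_div] at hn2
      linarith
  · exact ⟨B + 1, by simpa using hup⟩
  · refine ⟨-(A + 1), ?_⟩
    simp only [eventually_map]
    filter_upwards [hlow] with n hn
    rw [hneg, neg_div] at hn
    simp only [ge_iff_le]
    linarith

end Ergodic

/-! ### Breiman's ergodic theorem -/

section Breiman

variable {α : Type*} [MeasurableSpace α] {μ : Measure α} {T : α → α}

/-- If the integrals of nonnegative functions `D N` tend to zero, then for almost every `x` there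
are `N` for which the upper limit of the Birkhoff averages of `D N` at `x` is as small as desired. -/
theorem ae_exists_notMem_unboundedSums_of_tendsto_integral [IsFiniteMeasure μ]
    (hT : MeasurePreserving T μ μ) {D : ℕ → α → ℝ} (hD : ∀ N, Integrable (D N) μ)
    (hmD : ∀ N, Measurable (D N)) (hD0 : ∀ N x, 0 ≤ D N x)
    (hlim : Tendsto (fun N => ∫ x, D N x ∂μ) atTop (𝓝 0)) {ε : ℝ} (hε : 0 < ε) :
    ∀ᵐ x ∂μ, ∃ N, x ∉ unboundedSums T fun y => D N y - ε := by
  set E : Set α := ⋂ N, unboundedSums T fun y => D N y - ε with hEdef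
  have hE : ∀ N, MeasurableSet (unboundedSums T fun y => D N y - ε) := fun N =>
    measurableSet_unboundedSums hT.measurable ((hmD N).sub_const _)
  have hb : ∀ N, ε * μ.real E ≤ ∫ x, D N x ∂μ := fun N =>
    calc ε * μ.real E ≤ ε * μ.real (unboundedSums T fun y => D N y - ε) := by
          gcongr
          · exact measure_ne_top _ _
          · exact Set.iInter_subset _ N
      _ ≤ ∫ x in unboundedSums T fun y => D N y - ε, D N x ∂μ :=
          mul_measureReal_le_setIntegral hT (hD N) (hmD N) ε (hE N) (preimage_unboundedSums _)
            le_rfl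
      _ ≤ ∫ x, D N x ∂μ := setIntegral_le_integral (hD N) (Eventually.of_forall (hD0 N))
  have h0 : ε * μ.real E ≤ 0 := ge_of_tendsto' hlim hb
  have h1 : μ.real E = 0 := le_antisymm (by
    by_contra! hc
    nlinarith) measureReal_nonneg
  filter_upwards [measure_eq_zero_iff_ae_notMem.mp ((measureReal_eq_zero_iff).mp h1)] with x hx
  simpa [hEdef] using hx

/-- Breiman's form of the ergodic theorem: for functions `g n` converging almost everywhere and
dominated by an integrable function, the averages of `g (n - 1 - k) (T^[k] x)` over `k < n`
converge almost everywhere. -/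
theorem ae_exists_tendsto_breiman_average [IsFiniteMeasure μ] (hT : MeasurePreserving T μ μ)
    {g : ℕ → α → ℝ} (hmg : ∀ n, Measurable (g n)) {G : α → ℝ} (hG : Integrable G μ)
    (hgG : ∀ᵐ x ∂μ, ∀ n, |g n x| ≤ G x)
    (hlim : ∀ᵐ x ∂μ, ∃ c : ℝ, Tendsto (fun n => g n x) atTop (𝓝 c)) :
    ∀ᵐ x ∂μ, ∃ c : ℝ, Tendsto
      (fun n : ℕ => (∑ k ∈ Finset.range n, g (n - 1 - k) (T^[k] x)) / n) atTop (𝓝 c) := by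
  obtain ⟨f, hmf, hf⟩ := measurable_limit_of_tendsto_metrizable_ae
    (fun n => (hmg n).aemeasurable) hlim
  have hfG : ∀ᵐ x ∂μ, |f x| ≤ G x := by
    filter_upwards [hgG, hf] with x hx hfx
    exact le_of_tendsto' hfx.abs hx
  have hfi : Integrable f μ := hG.mono' hmf.aestronglyMeasurable hfG
  -- the tail oscillation of the sequence
  let D : ℕ → α → ℝ := fun N x => ⨆ j, |g (j + N) x - f x|
  have hmD : ∀ N, Measurable (D N) := fun N =>
    Measurable.iSup fun j => ((hmg _).sub hmf).abs
  have hD0 : ∀ N x, 0 ≤ D N x := fun N x => Real.iSup_nonneg fun j => abs_nonneg _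
  have hterm : ∀ᵐ x ∂μ, ∀ j, |g j x - f x| ≤ 2 * G x := by
    filter_upwards [hgG, hfG] with x hx hfx j
    have := abs_sub (g j x) (f x)
    have := hx j
    linarith
  have hbdd : ∀ᵐ x ∂μ, ∀ N, BddAbove (Set.range fun j => |g (j + N) x - f x|) := by
    filter_upwards [hterm] with x hx N
    exact ⟨2 * G x, by rintro _ ⟨j, rfl⟩; exact hx _⟩
  have hDG : ∀ᵐ x ∂μ, ∀ N, D N x ≤ 2 * G x := by
    filter_upwards [hterm] with x hx N
    exact ciSup_le fun j => hx _
  have hDi : ∀ N, Integrable (D N) μ := fun N =>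
    (hG.const_mul 2).mono' (hmD N).aestronglyMeasurable (by
      filter_upwards [hDG] with x hx
      rw [Real.norm_of_nonneg (hD0 N x)]
      exact hx N)
  have hDlim : ∀ᵐ x ∂μ, Tendsto (fun N => D N x) atTop (𝓝 0) := by
    filter_upwards [hf] with x hx
    rw [Metric.tendsto_atTop]
    intro ε hε
    obtain ⟨N, hN⟩ := (Metric.tendsto_atTop.mp hx) (ε / 2) (half_pos hε)
    refine ⟨N, fun n hn => ?_⟩
    rw [Real.dist_0_eq_abs, abs_of_nonneg (hD0 n x)]
    refine lt_of_le_of_lt (ciSup_le fun j => ?_) (half_lt_self hε)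
    have := hN (j + n) (by omega)
    rw [Real.dist_eq] at this
    exact this.le
  have hint : Tendsto (fun N => ∫ x, D N x ∂μ) atTop (𝓝 0) := by
    have := tendsto_integral_of_dominated_convergence (μ := μ) (F := D) (f := fun _ => (0 : ℝ))
      (fun x => 2 * G x) (fun N => (hmD N).aestronglyMeasurable) (hG.const_mul 2)
      (fun N => by
        filter_upwards [hDG] with x hx
        rw [Real.norm_of_nonneg (hD0 N x)]
        exact hx N) hDlim
    simpa using this
  have hsmall : ∀ᵐ x ∂μ, ∀ m : ℕ, ∃ N, x ∉ unboundedSums T fun y => D N y - 1 / ((m : ℝ) + 1) := by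
    rw [ae_all_iff]
    exact fun m => ae_exists_notMem_unboundedSums_of_tendsto_integral hT hDi hmD hD0 hint
      Nat.one_div_pos_of_nat
  have horb : ∀ᵐ x ∂μ, ∀ k N, BddAbove (Set.range fun j => |g (j + N) (T^[k] x) - f (T^[k] x)|) :=
    ae_all_iff.mpr fun k => (hT.iterate k).quasiMeasurePreserving.ae hbdd
  filter_upwards [hsmall, horb, ae_exists_tendsto_birkhoffSum_div hT hfi hmf,
    ae_exists_tendsto_birkhoffSum_div hT (hDi 0) (hmD 0)] with x hsx hox ⟨c, hc⟩ ⟨d, hd⟩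
  refine ⟨c, ?_⟩
  have hDle : ∀ k N j, N ≤ j → |g j (T^[k] x) - f (T^[k] x)| ≤ D N (T^[k] x) := by
    intro k N j hj
    have := le_ciSup (hox k N) (j - N)
    rwa [Nat.sub_add_cancel hj] at this
  -- the error against the Birkhoff sum of the limit: the last `N` terms are controlled by `D 0`,
  -- the others by `D N`
  have herr : ∀ N n, N ≤ n →
      |∑ k ∈ Finset.range n, g (n - 1 - k) (T^[k] x) - birkhoffSum T f n x| ≤
        birkhoffSum T (D N) n x + (birkhoffSum T (D 0) n x - birkhoffSum T (D 0) (n - N) x) := by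
    intro N n hn
    have hsplit : birkhoffSum T (D 0) n x - birkhoffSum T (D 0) (n - N) x
        = ∑ k ∈ Finset.range n, if n - N ≤ k then D 0 (T^[k] x) else 0 := by
      rw [sub_eq_iff_eq_add, ← Finset.sum_filter, add_comm]
      unfold birkhoffSum
      rw [← Finset.sum_filter_add_sum_filter_not (Finset.range n) (fun k => n - N ≤ k), add_comm]
      congr 1
      refine Finset.sum_congr ?_ fun _ _ => rfl
      ext k
      simp only [Finset.mem_filter, Finset.mem_range]
      omega
    rw [hsplit]
    unfold birkhoffSum
    rw [← Finset.sum_sub_distrib, ← Finset.sum_add_distrib]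
    refine (Finset.abs_sum_le_sum_abs _ _).trans (Finset.sum_le_sum fun k hk => ?_)
    rw [Finset.mem_range] at hk
    split_ifs with h
    · have := hDle k 0 (n - 1 - k) (Nat.zero_le _)
      have := hD0 N (T^[k] x)
      linarith
    · have := hDle k N (n - 1 - k) (by omega)
      linarith
  have hmain : Tendsto (fun n : ℕ => (∑ k ∈ Finset.range n, g (n - 1 - k) (T^[k] x)) / n
      - birkhoffSum T f n x / n) atTop (𝓝 0) := by
    rw [Metric.tendsto_atTop']
    intro ε hε
    obtain ⟨m, hm⟩ := exists_nat_one_div_lt (half_pos hε)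
    obtain ⟨N, hN⟩ := hsx m
    have h1 := eventually_birkhoffSum_le hm hN
    have hratio : Tendsto (fun n : ℕ => ((n - N : ℕ) : ℝ) / n) atTop (𝓝 1) := by
      have h2 : Tendsto (fun n : ℕ => 1 - (N : ℝ) / n) atTop (𝓝 (1 - 0)) :=
        tendsto_const_nhds.sub (tendsto_const_div_atTop_nhds_zero_nat _)
      rw [sub_zero] at h2
      refine h2.congr' ?_
      filter_upwards [eventually_ge_atTop (max N 1)] with n hn
      have : (n : ℝ) ≠ 0 := by
        have : 1 ≤ n := (le_max_right _ _).trans hn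
        positivity
      rw [Nat.cast_sub ((le_max_left _ _).trans hn)]
      field_simp
    have h2 : Tendsto (fun n : ℕ => birkhoffSum T (D 0) n x / n
        - birkhoffSum T (D 0) (n - N) x / n) atTop (𝓝 0) := by
      have h3 : Tendsto (fun n : ℕ => birkhoffSum T (D 0) (n - N) x / (n - N : ℕ)
          * (((n - N : ℕ) : ℝ) / n)) atTop (𝓝 (d * 1)) :=
        (hd.comp (tendsto_sub_atTop_nat N)).mul hratio
      rw [mul_one] at h3
      rw [← sub_self d]
      refine hd.sub (h3.congr' ?_)
      filter_upwards [eventually_gt_atTop N] with n hn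
      have : ((n - N : ℕ) : ℝ) ≠ 0 := by
        have : 0 < n - N := by omega
        positivity
      field_simp
    have h4 := (h1.and ((h2.eventually (gt_mem_nhds (half_pos hε))).and
      (eventually_ge_atTop (max N 1)))).exists_forall_of_atTop
    obtain ⟨M, hM⟩ := h4
    refine ⟨M, fun n hn => ?_⟩
    obtain ⟨h5, h6, h7⟩ := hM n hn.le
    have hn1 : (0 : ℝ) < n := by
      have : 1 ≤ n := (le_max_right _ _).trans h7
      positivity
    rw [Real.dist_0_eq_abs, ← sub_div, abs_div, abs_of_pos hn1]
    calc _ ≤ (birkhoffSum T (D N) n x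
          + (birkhoffSum T (D 0) n x - birkhoffSum T (D 0) (n - N) x)) / n := by
          gcongr
          exact herr N n ((le_max_left _ _).trans h7)
      _ = birkhoffSum T (D N) n x / n + (birkhoffSum T (D 0) n x / n
          - birkhoffSum T (D 0) (n - N) x / n) := by ring
      _ < ε := by linarith
  simpa using hmain.add hc

/-- Functions with an exponentially decaying maximal tail have an integrable common bound. -/
theorem exists_integrable_bound_of_exp_tail [IsFiniteMeasure μ] {g : ℕ → α → ℝ}
    (hmg : ∀ n, Measurable (g n)) {C : ℝ≥0∞} (hC : C ≠ ∞)
    (htail : ∀ t : ℝ, μ {x | ∃ n, t < |g n x|} ≤ C * ENNReal.ofReal (Real.exp (-t))) :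
    ∃ G : α → ℝ, Integrable G μ ∧ ∀ᵐ x ∂μ, ∀ n, |g n x| ≤ G x := by
  let G : α → ℝ := fun x => ⨆ n, |g n x|
  have hmG : Measurable G := Measurable.iSup fun n => (hmg n).abs
  have hG0 : ∀ x, 0 ≤ G x := fun x => Real.iSup_nonneg fun n => abs_nonneg _
  refine ⟨G, ⟨hmG.aestronglyMeasurable, ?_⟩, ?_⟩
  · rw [hasFiniteIntegral_iff_ofReal (Eventually.of_forall hG0),
      lintegral_eq_lintegral_meas_lt μ (Eventually.of_forall hG0) hmG.aemeasurable]
    calc ∫⁻ t in Set.Ioi 0, μ {x | t < G x}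
        ≤ ∫⁻ t in Set.Ioi (0 : ℝ), C * ENNReal.ofReal (Real.exp (-t)) := by
          refine lintegral_mono fun t => (measure_mono fun x hx => ?_).trans (htail t)
          exact exists_lt_of_lt_ciSup hx
      _ = C * ∫⁻ t in Set.Ioi (0 : ℝ), ENNReal.ofReal (Real.exp (-t)) :=
          lintegral_const_mul' _ _ hC
      _ < ∞ := by
          refine ENNReal.mul_lt_top hC.lt_top ?_
          have := (integrableOn_exp_neg_Ioi 0).2
          rwa [hasFiniteIntegral_iff_ofReal
            (Eventually.of_forall fun t => (Real.exp_pos _).le)] at this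
  · have h0 : μ {x | ∀ t : ℕ, ∃ n, (t : ℝ) < |g n x|} = 0 := by
      have hlim : Tendsto (fun t : ℕ => C * ENNReal.ofReal (Real.exp (-(t : ℝ)))) atTop (𝓝 0) := by
        have h1 : Tendsto (fun t : ℕ => ENNReal.ofReal (Real.exp (-(t : ℝ)))) atTop (𝓝 0) := by
          rw [← ENNReal.ofReal_zero]
          exact ENNReal.tendsto_ofReal (Real.tendsto_exp_neg_atTop_nhds_zero.comp
            tendsto_natCast_atTop_atTop)
        simpa using ENNReal.Tendsto.const_mul h1 (Or.inr hC)
      refine le_antisymm (ge_of_tendsto' hlim fun t => ?_) bot_le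
      exact (measure_mono fun x hx => by exact hx t).trans (htail t)
    filter_upwards [measure_eq_zero_iff_ae_notMem.mp h0] with x hx n
    simp only [not_forall, not_exists, not_lt] at hx
    obtain ⟨t, ht⟩ := hx
    exact le_ciSup (f := fun n => |g n x|) ⟨t, by rintro _ ⟨j, rfl⟩; exact ht j⟩ n

end Breiman

/-! ### A weak-type covering estimate -/

/-- `N` is an admissible constant in the following estimate for measures on the line: if, for all
`x ∈ S`, the part of `S` that `c` sends to `closedBall (c x) (ρ x)` has measure at most `ε` times
that of the ball, then `S` has measure at most `N * ε` times the total mass. -/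
def IsCoveringConstant (N : ℕ) : Prop :=
  ∀ (μ : Measure ℝ) (S : Set ℝ) (c ρ : ℝ → ℝ) (R : ℝ) (ε : ℝ≥0∞),
    (∀ x ∈ S, 0 < ρ x) → (∀ x ∈ S, ρ x ≤ R) →
    (∀ x ∈ S, μ (S ∩ c ⁻¹' Metric.closedBall (c x) (ρ x)) ≤
      ε * μ (Metric.closedBall (c x) (ρ x))) →
    μ S ≤ N * (ε * μ Set.univ)

/-- By Besicovitch's theorem boundedly many disjoint families of the balls
`closedBall (c x) (ρ x)`, `x ∈ S`, suffice to cover `c '' S`. -/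
theorem exists_isCoveringConstant : ∃ N : ℕ, IsCoveringConstant N := by
  obtain ⟨N, τ, hτ, hN⟩ := HasBesicovitchCovering.no_satelliteConfig (α := ℝ)
  refine ⟨N, fun μ S c ρ R ε hpos hR hS => ?_⟩
  let q : Besicovitch.BallPackage S ℝ :=
    { c := fun x => c x
      r := fun x => ρ x
      rpos := fun x => hpos x x.2
      r_bound := R
      r_le := fun x => hR x x.2 }
  obtain ⟨s, hdisj, hcov⟩ := Besicovitch.exist_disjoint_covering_families hτ hN q
  have hcount : ∀ i, (s i).Countable := fun i =>
    (hdisj i).countable_of_nonempty_interior fun j _ => by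
      rw [interior_closedBall _ (q.rpos j).ne']
      exact ⟨q.c j, Metric.mem_ball_self (q.rpos j)⟩
  have hsub : S ⊆ ⋃ i : Fin N, ⋃ j ∈ s i,
      S ∩ c ⁻¹' Metric.closedBall (q.c j) (q.r j) := by
    intro x hx
    have h := hcov ⟨⟨x, hx⟩, rfl⟩
    simp only [Set.mem_iUnion] at h ⊢
    obtain ⟨i, j, hj, hxj⟩ := h
    exact ⟨i, j, hj, hx, Metric.ball_subset_closedBall hxj⟩
  calc μ S ≤ ∑ i : Fin N, μ (⋃ j ∈ s i, S ∩ c ⁻¹' Metric.closedBall (q.c j) (q.r j)) :=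
        (measure_mono hsub).trans (measure_iUnion_fintype_le _ _)
    _ ≤ ∑ _i : Fin N, ε * μ Set.univ := by
        refine Finset.sum_le_sum fun i _ => ?_
        calc μ (⋃ j ∈ s i, S ∩ c ⁻¹' Metric.closedBall (q.c j) (q.r j))
            ≤ ∑' j : s i, μ (S ∩ c ⁻¹' Metric.closedBall (q.c j) (q.r j)) :=
              measure_biUnion_le _ (hcount i) _
          _ ≤ ∑' j : s i, ε * μ (Metric.closedBall (q.c j) (q.r j)) :=
              ENNReal.tsum_le_tsum fun j => hS _ j.1.2
          _ = ε * ∑' j : s i, μ (Metric.closedBall (q.c j) (q.r j)) := ENNReal.tsum_mul_left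
          _ = ε * μ (⋃ j ∈ s i, Metric.closedBall (q.c j) (q.r j)) := by
              rw [measure_biUnion (hcount i) (hdisj i) fun _ _ => measurableSet_closedBall]
          _ ≤ ε * μ Set.univ := by gcongr; exact Set.subset_univ _
    _ = N * (ε * μ Set.univ) := by simp

/-! ### Masses of small balls along an orbit of the beta map -/

section BetaMap

variable {β : ℝ} {μ : Measure ℝ}

/-- The interval on which `betaMap β` is the affine map `x ↦ β * x - i`. -/
def betaBranch (β : ℝ) (i : ℤ) : Set ℝ := {x | ⌊β * x⌋ = i}

theorem measurableSet_betaBranch (β : ℝ) (i : ℤ) : MeasurableSet (betaBranch β i) :=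
  Int.measurable_floor.comp (measurable_const_mul β) (measurableSet_singleton i)

theorem dist_betaMap (hβ : 1 < β) {i : ℤ} {x y : ℝ} (hx : x ∈ betaBranch β i)
    (hy : y ∈ betaBranch β i) : dist (betaMap β y) (betaMap β x) = β * dist y x := by
  have h1 : ⌊β * x⌋ = i := hx
  have h2 : ⌊β * y⌋ = i := hy
  rw [betaMap, betaMap, Int.fract, Int.fract, h1, h2, Real.dist_eq, Real.dist_eq,
    show β * y - i - (β * x - i) = β * (y - x) by ring, abs_mul, abs_of_pos (by linarith)]

/-- The logarithm of the mass of the closed ball of radius `2 / β ^ n`. The factor `2` makes the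
ball of index `0` around a point of `[0, 1]` contain the whole unit interval. -/
noncomputable def ballLog (β : ℝ) (μ : Measure ℝ) (n : ℕ) (x : ℝ) : ℝ :=
  Real.log (μ.real (Metric.closedBall x (2 / β ^ n)))

/-- The logarithmic gain of mass when the ball of index `n + 1` around `x` is replaced by the ball
of index `n` around the image of `x`. -/
noncomputable def ballLogGain (β : ℝ) (μ : Measure ℝ) (n : ℕ) (x : ℝ) : ℝ :=
  ballLog β μ n (betaMap β x) - ballLog β μ (n + 1) x

theorem neg_ballLog_eq (n : ℕ) (x : ℝ) :
    -ballLog β μ n x = -ballLog β μ 0 ((betaMap β)^[n] x) +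
      ∑ k ∈ Finset.range n, ballLogGain β μ (n - 1 - k) ((betaMap β)^[k] x) := by
  induction n generalizing x with
  | zero => simp
  | succ n ih =>
    have h := ih (betaMap β x)
    rw [Finset.sum_range_succ', Function.iterate_succ_apply]
    simp only [Nat.add_sub_cancel, Nat.sub_zero, Function.iterate_zero, id_eq,
      Function.iterate_succ_apply]
    have h2 : ∑ k ∈ Finset.range n, ballLogGain β μ (n - (k + 1)) ((betaMap β)^[k] (betaMap β x)) =
        ∑ k ∈ Finset.range n, ballLogGain β μ (n - 1 - k) ((betaMap β)^[k] (betaMap β x)) :=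
      Finset.sum_congr rfl fun k _ => by rw [Nat.sub_sub, add_comm 1 k]
    rw [h2]
    have h3 : ballLogGain β μ n x = ballLog β μ n (betaMap β x) - ballLog β μ (n + 1) x := rfl
    linarith

theorem measurable_betaMap (β : ℝ) : Measurable (betaMap β) :=
  measurable_fract.comp (measurable_const_mul β)

theorem measurable_ballLog [IsFiniteMeasure μ] (n : ℕ) : Measurable (ballLog β μ n) := by
  have hs : MeasurableSet {p : ℝ × ℝ | dist p.2 p.1 ≤ 2 / β ^ n} :=
    measurableSet_le (measurable_snd.dist measurable_fst) measurable_const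
  exact Real.measurable_log.comp (measurable_measure_prodMk_left (ν := μ) hs).ennreal_toReal

theorem measurable_ballLogGain [IsFiniteMeasure μ] (n : ℕ) : Measurable (ballLogGain β μ n) :=
  ((measurable_ballLog n).comp (measurable_betaMap β)).sub (measurable_ballLog _)

theorem ae_mem_Ico (hinv : MeasurePreserving (betaMap β) μ μ) : ∀ᵐ x ∂μ, x ∈ Set.Ico (0 : ℝ) 1 := by
  have h : ∀ᵐ y ∂(μ.map (betaMap β)), y ∈ Set.Ico (0 : ℝ) 1 := by
    refine (ae_map_iff hinv.aemeasurable measurableSet_Ico).mpr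
      (Eventually.of_forall fun x => ⟨Int.fract_nonneg _, Int.fract_lt_one _⟩)
  rwa [hinv.map_eq] at h

theorem closedBall_real_pos [IsFiniteMeasure μ] {x r : ℝ} (hx : x ∈ μ.support) (hr : 0 < r) :
    0 < μ.real (Metric.closedBall x r) :=
  ENNReal.toReal_pos (Measure.mem_support_iff_forall x |>.mp hx _
    (Metric.closedBall_mem_nhds x hr)).ne' (measure_ne_top _ _)

theorem betaMap_scale (hβ : 1 < β) (j : ℕ) : β * (2 / β ^ (j + 1)) = 2 / β ^ j := by
  have : β ≠ 0 := by linarith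
  rw [pow_succ]
  field_simp

/-- A point of a branch with a ball of mass much smaller than the mass of the image ball is rare. -/
theorem measure_contracting_le (hβ : 1 < β) {N : ℕ} (hN : IsCoveringConstant N)
    (μ : Measure ℝ) (i : ℤ) (ε : ℝ≥0∞) :
    μ {x | x ∈ betaBranch β i ∧ ∃ j : ℕ, μ (Metric.closedBall x (2 / β ^ (j + 1))) ≤
      ε * μ (Metric.closedBall (betaMap β x) (2 / β ^ j))} ≤ N * (ε * μ Set.univ) := by
  have hβ0 : 0 < β := by linarith
  set S := {x | x ∈ betaBranch β i ∧ ∃ j : ℕ, μ (Metric.closedBall x (2 / β ^ (j + 1))) ≤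
      ε * μ (Metric.closedBall (betaMap β x) (2 / β ^ j))}
  have hj : ∀ x : ℝ, ∃ j : ℕ, x ∈ S → μ (Metric.closedBall x (2 / β ^ (j + 1))) ≤
      ε * μ (Metric.closedBall (betaMap β x) (2 / β ^ j)) := fun x => by
    by_cases hx : x ∈ S
    · obtain ⟨j, h⟩ := hx.2
      exact ⟨j, fun _ => h⟩
    · exact ⟨0, fun h => absurd h hx⟩
  choose j hj using hj
  refine hN μ S (betaMap β) (fun x => 2 / β ^ j x) 2 ε (fun x _ => by positivity)
    (fun x _ => div_le_self (by norm_num) (one_le_pow₀ hβ.le)) fun x hx => ?_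
  refine (measure_mono ?_).trans (hj x hx)
  rintro y ⟨hy, hyx⟩
  rw [Set.mem_preimage, Metric.mem_closedBall, dist_betaMap hβ hx.1 hy.1,
    ← betaMap_scale hβ] at hyx
  exact le_of_mul_le_mul_left hyx hβ0

/-- A point of a branch with a ball of mass much larger than the mass of the image ball is rare. -/
theorem measure_expanding_le (hβ : 1 < β) {N : ℕ} (hN : IsCoveringConstant N)
    (hinv : MeasurePreserving (betaMap β) μ μ) (i : ℤ) (ε : ℝ≥0∞) :
    μ {x | x ∈ betaBranch β i ∧ ∃ j : ℕ, μ (Metric.closedBall (betaMap β x) (2 / β ^ j)) ≤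
      ε * μ (Metric.closedBall x (2 / β ^ (j + 1)))} ≤ N * (ε * μ Set.univ) := by
  have hβ0 : 0 < β := by linarith
  set S := {x | x ∈ betaBranch β i ∧ ∃ j : ℕ, μ (Metric.closedBall (betaMap β x) (2 / β ^ j)) ≤
      ε * μ (Metric.closedBall x (2 / β ^ (j + 1)))}
  have hj : ∀ x : ℝ, ∃ j : ℕ, x ∈ S → μ (Metric.closedBall (betaMap β x) (2 / β ^ j)) ≤
      ε * μ (Metric.closedBall x (2 / β ^ (j + 1))) := fun x => by
    by_cases hx : x ∈ S
    · obtain ⟨j, h⟩ := hx.2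
      exact ⟨j, fun _ => h⟩
    · exact ⟨0, fun h => absurd h hx⟩
  choose j hj using hj
  refine hN μ S id (fun x => 2 / β ^ (j x + 1)) 2 ε (fun x _ => by positivity)
    (fun x _ => div_le_self (by norm_num) (one_le_pow₀ hβ.le)) fun x hx => ?_
  refine le_trans ?_ (hj x hx)
  rw [← hinv.measure_preimage measurableSet_closedBall.nullMeasurableSet]
  refine measure_mono ?_
  rintro y ⟨hy, hyx⟩
  rw [Set.mem_preimage, Metric.mem_closedBall, dist_betaMap hβ hx.1 hy.1, ← betaMap_scale hβ]
  exact mul_le_mul_of_nonneg_left hyx hβ0.le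

theorem measure_le_of_lt_log_sub_log [IsFiniteMeasure μ] {s u : Set ℝ} (hs : 0 < μ.real s)
    (hu : 0 < μ.real u) {t : ℝ} (h : t < Real.log (μ.real u) - Real.log (μ.real s)) :
    μ s ≤ ENNReal.ofReal (Real.exp (-t)) * μ u := by
  have h1 : μ.real s ≤ Real.exp (-t) * μ.real u := by
    rw [← Real.log_le_log_iff hs (by positivity), Real.log_mul (Real.exp_pos _).ne' hu.ne',
      Real.log_exp]
    linarith
  rw [← ofReal_measureReal (μ := μ) (s := s), ← ofReal_measureReal (μ := μ) (s := u),
    ← ENNReal.ofReal_mul (Real.exp_pos _).le]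
  exact ENNReal.ofReal_le_ofReal h1

/-- The gains `ballLogGain β μ n` have a common exponential tail. -/
theorem exists_ballLogGain_tail (hβ : 1 < β) [IsFiniteMeasure μ]
    (hinv : MeasurePreserving (betaMap β) μ μ) : ∃ C : ℝ≥0∞, C ≠ ∞ ∧ ∀ t : ℝ,
      μ {x | ∃ n, t < |ballLogGain β μ n x|} ≤ C * ENNReal.ofReal (Real.exp (-t)) := by
  have hβ0 : 0 < β := by linarith
  obtain ⟨N, hN⟩ := exists_isCoveringConstant
  let I : Finset ℤ := Finset.Icc 0 ⌊β⌋
  refine ⟨I.card * (2 * (N * μ Set.univ)), ?_, fun t => ?_⟩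
  · exact ENNReal.mul_ne_top (by simp) (ENNReal.mul_ne_top (by simp)
      (ENNReal.mul_ne_top (by simp) (measure_ne_top _ _)))
  set ε := ENNReal.ofReal (Real.exp (-t))
  let S₁ : ℤ → Set ℝ := fun i => {x | x ∈ betaBranch β i ∧ ∃ j : ℕ,
    μ (Metric.closedBall x (2 / β ^ (j + 1))) ≤
      ε * μ (Metric.closedBall (betaMap β x) (2 / β ^ j))}
  let S₂ : ℤ → Set ℝ := fun i => {x | x ∈ betaBranch β i ∧ ∃ j : ℕ,
    μ (Metric.closedBall (betaMap β x) (2 / β ^ j)) ≤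
      ε * μ (Metric.closedBall x (2 / β ^ (j + 1)))}
  have hsupp : ∀ᵐ x ∂μ, x ∈ μ.support := Measure.support_mem_ae
  have hsub : {x | ∃ n, t < |ballLogGain β μ n x|} ≤ᵐ[μ] ⋃ i ∈ I, S₁ i ∪ S₂ i := by
    filter_upwards [hsupp, hinv.quasiMeasurePreserving.ae hsupp, ae_mem_Ico hinv]
      with x hx hTx hx01 hxt
    obtain ⟨n, hn⟩ := hxt
    have hxI : ⌊β * x⌋ ∈ I := by
      rw [Finset.mem_Icc]
      exact ⟨Int.floor_nonneg.mpr (mul_nonneg hβ0.le hx01.1),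
        Int.floor_le_floor (by nlinarith [hx01.2])⟩
    have h1 := closedBall_real_pos hx (show 0 < 2 / β ^ (n + 1) by positivity)
    have h2 := closedBall_real_pos hTx (show 0 < 2 / β ^ n by positivity)
    refine Set.mem_iUnion₂.mpr ⟨_, hxI, ?_⟩
    rcases lt_abs.mp hn with h | h
    · exact Or.inl ⟨rfl, n, measure_le_of_lt_log_sub_log h1 h2 h⟩
    · refine Or.inr ⟨rfl, n, measure_le_of_lt_log_sub_log h2 h1 (h.trans_eq ?_)⟩
      rw [ballLogGain, neg_sub]
      rfl
  calc μ {x | ∃ n, t < |ballLogGain β μ n x|} ≤ μ (⋃ i ∈ I, S₁ i ∪ S₂ i) := measure_mono_ae hsub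
    _ ≤ ∑ i ∈ I, (μ (S₁ i) + μ (S₂ i)) :=
        (measure_biUnion_finset_le _ _).trans (Finset.sum_le_sum fun i _ => measure_union_le _ _)
    _ ≤ ∑ _i ∈ I, (N * (ε * μ Set.univ) + N * (ε * μ Set.univ)) := by
        gcongr with i _
        · exact measure_contracting_le hβ hN μ i ε
        · exact measure_expanding_le hβ hN hinv i ε
    _ = I.card * (2 * (N * μ Set.univ)) * ε := by
        rw [Finset.sum_const, nsmul_eq_mul]
        ring

theorem tendsto_scale (hβ : 1 < β) : Tendsto (fun n : ℕ => 2 / β ^ n) atTop (𝓝[>] 0) := by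
  refine tendsto_nhdsWithin_iff.mpr ⟨?_, Eventually.of_forall fun n => ?_⟩
  · exact tendsto_const_nhds.div_atTop (tendsto_pow_atTop_atTop_of_one_lt hβ)
  · have : 0 < β := by linarith
    exact Set.mem_Ioi.mpr (by positivity)

theorem tendsto_ballLog_of_atom (hβ : 1 < β) [IsFiniteMeasure μ] {x : ℝ} (hx : μ {x} ≠ 0) :
    Tendsto (fun n => ballLog β μ n x) atTop (𝓝 (Real.log (μ.real {x}))) := by
  have h1 := (tendsto_measure_cthickening_of_isClosed (μ := μ) (s := {x})
    ⟨1, one_pos, measure_ne_top _ _⟩ isClosed_singleton).comp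
      ((tendsto_scale hβ).mono_right nhdsWithin_le_nhds)
  have h2 := (ENNReal.tendsto_toReal (measure_ne_top μ {x})).comp h1
  refine ((Real.continuousAt_log (ENNReal.toReal_pos hx (measure_ne_top _ _)).ne').tendsto.comp
    h2).congr fun n => ?_
  have : 0 ≤ 2 / β ^ n := by
    have : 0 < β := by linarith
    positivity
  simp [ballLog, Metric.cthickening_singleton _ this, Measure.real]

theorem betaBranch_mem_nhds {x : ℝ} (hx : ∀ i : ℤ, β * x ≠ i) :
    betaBranch β ⌊β * x⌋ ∈ 𝓝 x := by
  have hopen : IsOpen ((fun y => β * y) ⁻¹' Set.Ioo (⌊β * x⌋ : ℝ) (⌊β * x⌋ + 1)) :=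
    isOpen_Ioo.preimage (by fun_prop)
  refine mem_of_superset (hopen.mem_nhds ⟨?_, Int.lt_floor_add_one _⟩) fun y hy => ?_
  · exact lt_of_le_of_ne (Int.floor_le _) (hx _).symm
  · exact Int.floor_eq_iff.mpr ⟨hy.1.le, hy.2⟩

/-- The gains converge almost everywhere. In the interior of a branch `A` the mass of a small ball
is the mass of the image ball for the push-forward of `μ.restrict A`, so that the gain converges to
minus the logarithm of a Radon-Nikodym derivative. At the endpoints of the branches only atoms
matter, and there both masses converge to positive numbers. -/
theorem ae_exists_tendsto_ballLogGain (hβ : 1 < β) [IsFiniteMeasure μ]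
    (hinv : MeasurePreserving (betaMap β) μ μ) :
    ∀ᵐ x ∂μ, ∃ c : ℝ, Tendsto (fun n => ballLogGain β μ n x) atTop (𝓝 c) := by
  have hβ0 : 0 < β := by linarith
  have hm := measurable_betaMap β
  let ν : ℤ → Measure ℝ := fun i => (μ.restrict (betaBranch β i)).map (betaMap β)
  have hfin : ∀ i, IsFiniteMeasure (ν i) := fun i => inferInstance
  have hle : ∀ i, ν i ≤ μ := fun i => by
    conv_rhs => rw [← hinv.map_eq]
    exact Measure.map_mono Measure.restrict_le_self hm
  have hder : ∀ᵐ x ∂μ, ∀ i, Tendsto (fun r => ν i (Metric.closedBall (betaMap β x) r) /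
      μ (Metric.closedBall (betaMap β x) r)) (𝓝[>] 0) (𝓝 ((ν i).rnDeriv μ (betaMap β x))) :=
    ae_all_iff.mpr fun i =>
      hinv.quasiMeasurePreserving.ae (Besicovitch.ae_tendsto_rnDeriv (ν i) μ)
  have htop : ∀ᵐ x ∂μ, ∀ i, (ν i).rnDeriv μ (betaMap β x) < ∞ :=
    ae_all_iff.mpr fun i => hinv.quasiMeasurePreserving.ae (Measure.rnDeriv_lt_top (ν i) μ)
  have hpos : ∀ᵐ x ∂μ, ∀ i, x ∈ betaBranch β i → 0 < (ν i).rnDeriv μ (betaMap β x) := by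
    refine ae_all_iff.mpr fun i => (ae_restrict_iff' (measurableSet_betaBranch β i)).mp ?_
    exact ae_of_ae_map hm.aemeasurable
      (Measure.rnDeriv_pos (Measure.absolutelyContinuous_of_le (hle i)))
  have hend : ∀ᵐ x ∂μ, ∀ i : ℤ, x = i / β → μ {x} ≠ 0 := by
    refine ae_all_iff.mpr fun i => ?_
    by_cases h : μ {(i / β : ℝ)} = 0
    · filter_upwards [measure_eq_zero_iff_ae_notMem.mp h] with x hx hxi
      exact absurd hxi hx
    · exact Eventually.of_forall fun x hx => hx ▸ h
  have hsupp : ∀ᵐ x ∂μ, x ∈ μ.support := Measure.support_mem_ae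
  filter_upwards [hder, htop, hpos, hend, hsupp, hinv.quasiMeasurePreserving.ae hsupp]
    with x hderx htopx hposx hendx hsx hsTx
  by_cases hx : ∀ i : ℤ, β * x ≠ i
  · set i := ⌊β * x⌋
    set d := (ν i).rnDeriv μ (betaMap β x)
    have hd0 : 0 < d := hposx i rfl
    have hdt : d ≠ ∞ := (htopx i).ne
    have h1 := (hderx i).comp (tendsto_scale hβ)
    have h2 := (ENNReal.tendsto_toReal hdt).comp h1
    have h3 := ((Real.continuousAt_log (ENNReal.toReal_pos hd0.ne' hdt).ne').tendsto.comp h2).neg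
    refine ⟨_, h3.congr' ?_⟩
    obtain ⟨r, hr, hball⟩ := Metric.nhds_basis_closedBall.mem_iff.mp (betaBranch_mem_nhds hx)
    have hsmall : ∀ᶠ n : ℕ in atTop, 2 / β ^ n < r :=
      ((tendsto_scale hβ).mono_right nhdsWithin_le_nhds).eventually (gt_mem_nhds hr)
    filter_upwards [(tendsto_add_atTop_nat 1).eventually hsmall] with n hn
    have hν : ν i (Metric.closedBall (betaMap β x) (2 / β ^ n)) =
        μ (Metric.closedBall x (2 / β ^ (n + 1))) := by
      rw [Measure.map_apply hm measurableSet_closedBall,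
        Measure.restrict_apply (hm measurableSet_closedBall)]
      refine le_antisymm (measure_mono ?_) (measure_mono ?_)
      · rintro y ⟨hy, hyi⟩
        rw [Set.mem_preimage, Metric.mem_closedBall, dist_betaMap hβ (rfl : x ∈ betaBranch β i) hyi,
          ← betaMap_scale hβ] at hy
        exact le_of_mul_le_mul_left hy hβ0
      · intro y hy
        have hyi : y ∈ betaBranch β i := hball (Metric.closedBall_subset_closedBall hn.le hy)
        refine ⟨?_, hyi⟩
        rw [Set.mem_preimage, Metric.mem_closedBall, dist_betaMap hβ (rfl : x ∈ betaBranch β i) hyi,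
          ← betaMap_scale hβ]
        exact mul_le_mul_of_nonneg_left hy hβ0.le
    have h4 := closedBall_real_pos hsx (show 0 < 2 / β ^ (n + 1) by positivity)
    have h5 := closedBall_real_pos hsTx (show 0 < 2 / β ^ n by positivity)
    simp only [Function.comp_apply, hν, ENNReal.toReal_div]
    change -Real.log (μ.real _ / μ.real _) = _
    rw [Real.log_div h4.ne' h5.ne', neg_sub]
    rfl
  · push Not at hx
    obtain ⟨i, hi⟩ := hx
    have hatom : μ {x} ≠ 0 := hendx i (by rw [← hi]; field_simp)
    have hatomT : μ {betaMap β x} ≠ 0 := by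
      rw [← hinv.measure_preimage (measurableSet_singleton _).nullMeasurableSet]
      exact fun h => hatom (measure_mono_null (by rintro _ rfl; rfl) h)
    exact ⟨_, (tendsto_ballLog_of_atom hβ hatomT).sub
      ((tendsto_ballLog_of_atom hβ hatom).comp (tendsto_add_atTop_nat 1))⟩

/-! ### Existence of the local dimension -/

/-- The exponential decay rate of the masses of the balls of radius `2 / β ^ n` exists almost
everywhere. -/
theorem ae_exists_tendsto_ballLog_div (hβ : 1 < β) [IsFiniteMeasure μ]
    (hinv : MeasurePreserving (betaMap β) μ μ) :
    ∀ᵐ x ∂μ, ∃ c : ℝ, Tendsto (fun n : ℕ => -ballLog β μ n x / n) atTop (𝓝 c) := by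
  obtain ⟨C, hC, htail⟩ := exists_ballLogGain_tail hβ hinv
  obtain ⟨G, hG, hgG⟩ := exists_integrable_bound_of_exp_tail measurable_ballLogGain hC htail
  have h01 : ∀ᵐ x ∂μ, ∀ n, (betaMap β)^[n] x ∈ Set.Ico (0 : ℝ) 1 :=
    ae_all_iff.mpr fun n => (hinv.iterate n).quasiMeasurePreserving.ae (ae_mem_Ico hinv)
  have huniv : ∀ x ∈ Set.Ico (0 : ℝ) 1, ballLog β μ 0 x = Real.log (μ.real Set.univ) := by
    intro x hx
    have : μ (Metric.closedBall x (2 / β ^ 0)) = μ Set.univ := by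
      refine measure_congr ?_
      filter_upwards [ae_mem_Ico hinv] with y hy
      refine propext ⟨fun _ => trivial, fun _ => ?_⟩
      change dist y x ≤ 2 / β ^ 0
      rw [Real.dist_eq, abs_le]
      constructor <;> norm_num <;> linarith [hx.1, hx.2, hy.1, hy.2]
    rw [ballLog, Measure.real, this]
    rfl
  filter_upwards [h01, ae_exists_tendsto_breiman_average hinv measurable_ballLogGain hG hgG
    (ae_exists_tendsto_ballLogGain hβ hinv)] with x hx ⟨c, hc⟩
  refine ⟨c, ?_⟩
  have h0 : Tendsto (fun n : ℕ => -Real.log (μ.real Set.univ) / n) atTop (𝓝 0) :=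
    tendsto_const_div_atTop_nhds_zero_nat _
  have h1 := h0.add hc
  rw [zero_add] at h1
  refine h1.congr fun n => ?_
  rw [neg_ballLog_eq n x, huniv _ (hx n), add_div]

/-- The decay rate along the scales `2 / β ^ n` determines the local dimension. -/
theorem hasLocalDim_of_tendsto_ballLog_div (hβ : 1 < β) [IsFiniteMeasure μ] {x c : ℝ}
    (hx : x ∈ μ.support) (hc : Tendsto (fun n : ℕ => -ballLog β μ n x / n) atTop (𝓝 c)) :
    HasLocalDim μ x (c / Real.log β) := by
  have hβ0 : 0 < β := by linarith
  have hlog : 0 < Real.log β := Real.log_pos hβ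
  -- the index of the smallest scale that is at least `r`
  let n : ℝ → ℕ := fun r => ⌊(Real.log 2 - Real.log r) / Real.log β⌋₊
  have hL : Tendsto (fun r : ℝ => -Real.log r) (𝓝[>] 0) atTop :=
    tendsto_neg_atBot_atTop.comp Real.tendsto_log_nhdsGT_zero
  have harg : Tendsto (fun r : ℝ => (Real.log 2 - Real.log r) / Real.log β) (𝓝[>] 0) atTop := by
    refine Tendsto.atTop_div_const hlog ?_
    simp only [sub_eq_add_neg]
    exact tendsto_atTop_add_const_left _ _ hL
  have hn : Tendsto n (𝓝[>] 0) atTop := tendsto_nat_floor_atTop.comp harg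
  have hratio : Tendsto (fun r => (n r : ℝ) / -Real.log r) (𝓝[>] 0) (𝓝 (1 / Real.log β)) := by
    have h1 := tendsto_nat_floor_div_atTop.comp harg
    have h2 : Tendsto (fun r : ℝ => Real.log 2 / -Real.log r + 1) (𝓝[>] 0) (𝓝 (0 + 1)) :=
      (tendsto_const_nhds.div_atTop hL).add tendsto_const_nhds
    have h3 := (h1.mul h2).mul_const (1 / Real.log β)
    rw [zero_add, one_mul, one_mul] at h3
    refine h3.congr' ?_
    filter_upwards [hL.eventually_gt_atTop 0, harg.eventually_gt_atTop 0] with r hr hr2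
    have h4 : Real.log 2 - Real.log r ≠ 0 := by
      intro h
      rw [h, zero_div] at hr2
      exact lt_irrefl _ hr2
    have h5 : Real.log r ≠ 0 := by linarith
    simp only [Function.comp_apply]
    change (n r : ℝ) / _ * _ * _ = _
    field_simp
    ring
  have hratio' : Tendsto (fun r => ((n r + 1 : ℕ) : ℝ) / -Real.log r) (𝓝[>] 0)
      (𝓝 (1 / Real.log β)) := by
    have h1 := hratio.add (tendsto_const_nhds (x := (1 : ℝ)).div_atTop hL)
    rw [add_zero] at h1
    refine h1.congr fun r => ?_
    push_cast
    ring
  have hlow := (hc.comp hn).mul hratio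
  have hup := ((hc.comp (tendsto_add_atTop_nat 1)).comp hn).mul hratio'
  rw [mul_one_div] at hlow hup
  refine tendsto_of_tendsto_of_tendsto_of_le_of_le' hlow hup ?_ ?_
  · filter_upwards [hL.eventually_gt_atTop 0, hn.eventually_gt_atTop 0,
      self_mem_nhdsWithin, harg.eventually_ge_atTop 0] with r hr hnr hr0 hr2
    have hr0 : 0 < r := hr0
    have hle : r ≤ 2 / β ^ n r := by
      have h1 : (n r : ℝ) ≤ (Real.log 2 - Real.log r) / Real.log β := Nat.floor_le hr2
      rw [le_div_iff₀ hlog] at h1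
      rw [← Real.log_le_log_iff hr0 (by positivity), Real.log_div (by norm_num) (by positivity),
        Real.log_pow]
      linarith
    have hpos : 0 < μ.real (Metric.ball x r) :=
      ENNReal.toReal_pos (Measure.mem_support_iff_forall x |>.mp hx _ (Metric.ball_mem_nhds x hr0)).ne'
        (measure_ne_top _ _)
    have hmono : Real.log (μ.real (Metric.ball x r)) ≤ ballLog β μ (n r) x :=
      Real.log_le_log hpos (measureReal_mono (Metric.ball_subset_closedBall.trans
        (Metric.closedBall_subset_closedBall hle)) (measure_ne_top _ _))
    have hn0 : (n r : ℝ) ≠ 0 := by positivity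
    simp only [Function.comp_apply]
    rw [div_mul_div_cancel₀ hn0, neg_div_neg_eq]
    exact div_le_div_of_nonpos_of_le (by linarith) hmono
  · filter_upwards [hL.eventually_gt_atTop 0, self_mem_nhdsWithin] with r hr hr0
    have hr0 : 0 < r := hr0
    have hle : 2 / β ^ (n r + 1) < r := by
      have h1 : (Real.log 2 - Real.log r) / Real.log β < (n r : ℝ) + 1 := Nat.lt_floor_add_one _
      rw [div_lt_iff₀ hlog] at h1
      rw [← Real.log_lt_log_iff (by positivity) hr0, Real.log_div (by norm_num) (by positivity),
        Real.log_pow]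
      push_cast
      linarith
    have hmono : ballLog β μ (n r + 1) x ≤ Real.log (μ.real (Metric.ball x r)) :=
      Real.log_le_log (closedBall_real_pos hx (by positivity))
        (measureReal_mono (Metric.closedBall_subset_ball hle) (measure_ne_top _ _))
    have hn0 : ((n r + 1 : ℕ) : ℝ) ≠ 0 := by positivity
    simp only [Function.comp_apply]
    rw [div_mul_div_cancel₀ hn0, neg_div_neg_eq]
    exact div_le_div_of_nonpos_of_le (by linarith) hmono

/-- The local dimension of an invariant measure of the beta map exists almost everywhere. -/
theorem ae_exists_hasLocalDim (hβ : 1 < β) [IsFiniteMeasure μ]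
    (hinv : MeasurePreserving (betaMap β) μ μ) : ∀ᵐ x ∂μ, ∃ δ : ℝ, HasLocalDim μ x δ := by
  filter_upwards [ae_exists_tendsto_ballLog_div hβ hinv, Measure.support_mem_ae] with x ⟨c, hc⟩ hx
  exact ⟨_, hasLocalDim_of_tendsto_ballLog_div hβ hx hc⟩

/-- An ergodic invariant measure of the beta map is exact dimensional: the decay rate of the masses
of balls at `x` is an invariant function of `x`, because `ballLogGain β μ n x` is bounded in `n`. -/
theorem exists_isExactDimensional_of_ergodic (hβ : 1 < β) [IsFiniteMeasure μ]
    (herg : Ergodic (betaMap β) μ) : ∃ δ : ℝ, IsExactDimensional μ δ := by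
  have hinv := herg.toMeasurePreserving
  obtain ⟨f, hmf, hf⟩ := measurable_limit_of_tendsto_metrizable_ae
    (fun n => (((measurable_ballLog (β := β) (μ := μ) n).neg).div_const (n : ℝ)).aemeasurable)
    (ae_exists_tendsto_ballLog_div hβ hinv)
  have hfT : f ∘ betaMap β =ᵐ[μ] f := by
    filter_upwards [hf, hinv.quasiMeasurePreserving.ae hf, ae_exists_tendsto_ballLogGain hβ hinv]
      with x hx hTx ⟨c, hc⟩
    refine tendsto_nhds_unique hTx ?_
    have h1 : Tendsto (fun n : ℕ => ballLogGain β μ n x / n) atTop (𝓝 0) :=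
      hc.div_atTop tendsto_natCast_atTop_atTop
    have h2 : Tendsto (fun n : ℕ => 1 + 1 / (n : ℝ)) atTop (𝓝 (1 + 0)) :=
      tendsto_const_nhds.add tendsto_one_div_atTop_nhds_zero_nat
    have h3 := ((hx.comp (tendsto_add_atTop_nat 1)).mul h2).sub h1
    rw [add_zero, mul_one, sub_zero] at h3
    refine h3.congr' ?_
    filter_upwards [eventually_gt_atTop 0] with n hn
    have hn0 : (n : ℝ) ≠ 0 := by positivity
    simp only [Function.comp_apply, ballLogGain, Pi.neg_apply]
    push_cast
    field_simp
    ring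
  obtain ⟨c, hc⟩ := herg.ae_eq_const_of_ae_eq_comp₀ hmf.nullMeasurable hfT
  refine ⟨c / Real.log β, ?_⟩
  filter_upwards [hf, hc, Measure.support_mem_ae] with x hx hcx hsx
  refine hasLocalDim_of_tendsto_ballLog_div hβ hsx ?_
  have : f x = c := hcx
  rw [← this]
  exact hx

end BetaMap

/-! ### Counting frequencies of a frame spectrum -/

section Frame

variable {μ : Measure ℝ} [IsFiniteMeasure μ] {Λ : Set ℝ}

theorem expChar_eq (l x : ℝ) :
    expChar l x = Complex.exp (((2 * Real.pi * l * x : ℝ) : ℂ) * Complex.I) := by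
  rw [expChar]
  congr 1
  push_cast
  ring

theorem norm_expChar (l x : ℝ) : ‖expChar l x‖ = 1 := by
  rw [expChar_eq, Complex.norm_exp_ofReal_mul_I]

theorem expChar_mul_conj (t l y : ℝ) :
    expChar t y * (starRingEnd ℂ) (expChar l y) = expChar (t - l) y := by
  simp only [expChar_eq, ← Complex.exp_conj, ← Complex.exp_add, map_mul, Complex.conj_ofReal,
    Complex.conj_I]
  congr 1
  push_cast
  ring

/-- On a ball of radius `1 / (8 h)` a character of frequency at most `h` has a variation of its
argument so small that its integral is at least half the mass of the ball. -/
theorem half_measureReal_le_norm_setIntegral_expChar {s h x : ℝ} (hh : 0 < h) (hs : |s| ≤ h) :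
    μ.real (Metric.ball x (1 / (8 * h))) / 2 ≤
      ‖∫ y in Metric.ball x (1 / (8 * h)), expChar s y ∂μ‖ := by
  set I := Metric.ball x (1 / (8 * h))
  have hmem := memLp_expChar μ s
  have hint : Integrable (expChar s) μ := hmem.integrable (by norm_num)
  have hint' : Integrable (fun y => expChar s y * expChar (-s) x) (μ.restrict I) :=
    (hint.mul_const _).integrableOn
  have h1 : ‖∫ y in I, expChar s y ∂μ‖ = ‖∫ y in I, expChar s y * expChar (-s) x ∂μ‖ := by
    rw [integral_mul_const, norm_mul, norm_expChar, mul_one]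
  have h2 : μ.real I / 2 = ∫ _ in I, (1 / 2 : ℝ) ∂μ := by
    rw [setIntegral_const, smul_eq_mul]
    ring
  rw [h1, h2]
  refine le_trans ?_ (Complex.re_le_norm _)
  have h3 : (∫ y in I, expChar s y * expChar (-s) x ∂μ).re =
      ∫ y in I, (expChar s y * expChar (-s) x).re ∂μ := (integral_re hint').symm
  rw [h3]
  refine setIntegral_mono_on (integrable_const _).integrableOn hint'.re measurableSet_ball
    fun y hy => ?_
  have h4 : expChar s y * expChar (-s) x =
      Complex.exp (((2 * Real.pi * s * (y - x) : ℝ) : ℂ) * Complex.I) := by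
    rw [expChar_eq, expChar_eq, ← Complex.exp_add]
    congr 1
    push_cast
    ring
  rw [h4, Complex.exp_ofReal_mul_I_re]
  have h5 : |y - x| < 1 / (8 * h) := by simpa [I, Real.dist_eq] using hy
  have h6 : |2 * Real.pi * s * (y - x)| ≤ 1 := by
    rw [abs_mul, abs_mul, abs_of_pos Real.two_pi_pos]
    calc 2 * Real.pi * |s| * |y - x| ≤ 2 * Real.pi * h * (1 / (8 * h)) := by gcongr
      _ = Real.pi / 4 := by field_simp; norm_num
      _ ≤ 1 := by linarith [Real.pi_le_four]
  have h7 := Real.one_sub_sq_div_two_le_cos (x := 2 * Real.pi * s * (y - x))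
  have h8 : (2 * Real.pi * s * (y - x)) ^ 2 ≤ 1 := (sq_le_one_iff_abs_le_one _).mpr h6
  linarith

/-- Testing the frame inequality on the indicator of a ball of radius `1 / (8 h)`, modulated by the
frequency `t`, bounds the number of frequencies within `h` of `t`. -/
theorem exists_encard_le_of_isFrameSpectrum (hΛ : IsFrameSpectrum μ Λ) :
    ∃ B : ℝ, 0 < B ∧ ∀ x t h : ℝ, 0 < h → 0 < μ.real (Metric.ball x (1 / (8 * h))) →
      ((Λ ∩ Metric.ball t h).encard : ℝ≥0∞) ≤
        ENNReal.ofReal (B / μ.real (Metric.ball x (1 / (8 * h)))) := by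
  obtain ⟨A, B, -, hB, hfr⟩ := hΛ
  refine ⟨4 * B, by positivity, fun x t h hh hpos => ?_⟩
  set I := Metric.ball x (1 / (8 * h))
  have hf : MemLp (I.indicator (expChar t)) 2 μ := (memLp_expChar μ t).indicator measurableSet_ball
  let φ : Lp ℂ 2 μ := hf.toLp
  have hφ : φ =ᵐ[μ] I.indicator (expChar t) := hf.coeFn_toLp
  obtain ⟨hsum, -, hup⟩ := hfr φ
  have hnorm : ‖φ‖ ^ 2 ≤ μ.real I := by
    have h1 : (‖φ‖ ^ 2 : ℝ) = RCLike.re (inner ℂ φ φ) :=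
      norm_sq_eq_re_inner _
    rw [h1, L2.inner_def]
    have h2 : ∫ y, inner ℂ (φ y) (φ y) ∂μ = ((μ.real I : ℝ) : ℂ) := by
      have h3 : (fun y => inner ℂ (φ y) (φ y)) =ᵐ[μ] I.indicator fun _ => (1 : ℂ) := by
        filter_upwards [hφ] with y hy
        rw [hy, inner_self_eq_norm_sq_to_K]
        by_cases hyI : y ∈ I <;> simp [hyI, norm_expChar]
      rw [integral_congr_ae h3, integral_indicator_const _ measurableSet_ball, Complex.real_smul,
        mul_one]
    rw [h2]
    simp
  have hterm : ∀ l : Λ, (l : ℝ) ∈ Metric.ball t h → (μ.real I) ^ 2 / 4 ≤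
      ‖inner ℂ ((memLp_expChar μ (l : ℝ)).toLp (expChar (l : ℝ))) φ‖ ^ 2 := by
    intro l hl
    have h1 : inner ℂ ((memLp_expChar μ (l : ℝ)).toLp (expChar (l : ℝ))) φ =
        ∫ y in I, expChar (t - l) y ∂μ := by
      rw [L2.inner_def, ← integral_indicator measurableSet_ball]
      refine integral_congr_ae ?_
      filter_upwards [hφ, (memLp_expChar μ (l : ℝ)).coeFn_toLp] with y hy hy'
      rw [hy, hy', RCLike.inner_apply]
      by_cases hyI : y ∈ I
      · rw [Set.indicator_of_mem hyI, Set.indicator_of_mem hyI, expChar_mul_conj]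
      · rw [Set.indicator_of_notMem hyI, Set.indicator_of_notMem hyI, zero_mul]
    have h2 : |t - l| ≤ h := by
      rw [abs_sub_comm, ← Real.dist_eq]
      exact (Metric.mem_ball.mp hl).le
    have h3 := half_measureReal_le_norm_setIntegral_expChar (μ := μ) (x := x) hh h2
    rw [h1]
    calc (μ.real I) ^ 2 / 4 = (μ.real I / 2) ^ 2 := by ring
      _ ≤ _ := by gcongr
  -- every finite part of `Λ ∩ ball t h` obeys the bound
  have hcard : ∀ F : Finset ℝ, (F : Set ℝ) ⊆ Λ ∩ Metric.ball t h →
      (F.card : ℝ) ≤ 4 * B / μ.real I := by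
    intro F hF
    let e : F → Λ := fun l => ⟨l, (hF l.2).1⟩
    have he : Function.Injective e := fun a b hab => Subtype.ext (congrArg (fun z : Λ => (z : ℝ)) hab)
    have h1 : (F.card : ℝ) * ((μ.real I) ^ 2 / 4) ≤ B * μ.real I := by
      calc (F.card : ℝ) * ((μ.real I) ^ 2 / 4) = ∑ _l ∈ Finset.univ.map ⟨e, he⟩,
            (μ.real I) ^ 2 / 4 := by simp
        _ ≤ ∑ l ∈ Finset.univ.map ⟨e, he⟩,
            ‖inner ℂ ((memLp_expChar μ (l : ℝ)).toLp (expChar (l : ℝ))) φ‖ ^ 2 := by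
              refine Finset.sum_le_sum fun l hl => hterm l ?_
              obtain ⟨a, -, rfl⟩ := Finset.mem_map.mp hl
              exact (hF a.2).2
        _ ≤ ∑' l : Λ, ‖inner ℂ ((memLp_expChar μ (l : ℝ)).toLp (expChar (l : ℝ))) φ‖ ^ 2 :=
              hsum.sum_le_tsum _ fun _ _ => by positivity
        _ ≤ B * ‖φ‖ ^ 2 := hup
        _ ≤ B * μ.real I := by gcongr
    rw [le_div_iff₀ hpos]
    refine le_of_mul_le_mul_right ?_ hpos
    linarith
  have hfin : (Λ ∩ Metric.ball t h).Finite := by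
    by_contra hinf
    obtain ⟨m, hm⟩ := exists_nat_gt (4 * B / μ.real I)
    obtain ⟨F, hF, hFc⟩ := (Set.not_finite.mp hinf).exists_subset_card_eq m
    have := hcard F hF
    rw [hFc] at this
    linarith
  rw [hfin.encard_eq_coe_toFinset_card]
  have h2 := hcard hfin.toFinset (by simp)
  calc ((hfin.toFinset.card : ℕ∞) : ℝ≥0∞) = ENNReal.ofReal (hfin.toFinset.card : ℝ) := by simp
    _ ≤ _ := ENNReal.ofReal_le_ofReal h2

/-- A frame spectrum has Beurling dimension at most the local dimension at any point of the
support: if `μ (ball x ρ) > ρ ^ s` for small `ρ`, balls of radius `h` contain `O(h ^ s)`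
frequencies. -/
theorem beurlingDim_le_of_hasLocalDim (hΛ : IsFrameSpectrum μ Λ) {x δ : ℝ} (hx : x ∈ μ.support)
    (hδ : HasLocalDim μ x δ) : beurlingDim Λ ≤ ENNReal.ofReal δ := by
  obtain ⟨B, hB, hcount⟩ := exists_encard_le_of_isFrameSpectrum hΛ
  refine iSup_le fun r => iSup_le fun hr => iSup_le fun hdens => ?_
  by_contra! hlt
  have hδr : δ < r := by
    by_contra! hc
    refine absurd hlt (not_lt.mpr ?_)
    rw [← ENNReal.ofReal_coe_nnreal]
    exact ENNReal.ofReal_le_ofReal hc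
  obtain ⟨s, hδs, hsr⟩ := exists_between hδr
  have hmass : ∀ᶠ ρ : ℝ in 𝓝[>] 0, ρ ^ s < μ.real (Metric.ball x ρ) := by
    filter_upwards [hδ.eventually (gt_mem_nhds hδs), self_mem_nhdsWithin,
      nhdsWithin_le_nhds (gt_mem_nhds one_pos)] with ρ hρ hρ0 hρ1
    have hρ0 : 0 < ρ := hρ0
    have hpos : 0 < μ.real (Metric.ball x ρ) :=
      ENNReal.toReal_pos (Measure.mem_support_iff_forall x |>.mp hx _
        (Metric.ball_mem_nhds x hρ0)).ne' (measure_ne_top _ _)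
    rw [div_lt_iff_of_neg (Real.log_neg hρ0 hρ1)] at hρ
    rwa [← Real.log_lt_log_iff (by positivity) hpos, Real.log_rpow hρ0]
  have hscale : Tendsto (fun h : ℝ => 1 / (8 * h)) atTop (𝓝[>] 0) := by
    refine tendsto_nhdsWithin_iff.mpr ⟨?_, ?_⟩
    · exact tendsto_const_nhds.div_atTop (tendsto_id.const_mul_atTop (by norm_num))
    · filter_upwards [eventually_gt_atTop 0] with h hh
      exact Set.mem_Ioi.mpr (by positivity)
  have hlim : Tendsto (fun h : ℝ => ENNReal.ofReal (B * 8 ^ s * h ^ (-((r : ℝ) - s)))) atTop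
      (𝓝 0) := by
    have := (tendsto_rpow_neg_atTop (sub_pos.mpr hsr)).const_mul (B * 8 ^ s)
    rw [mul_zero] at this
    rw [← ENNReal.ofReal_zero]
    exact ENNReal.tendsto_ofReal this
  have hzero : beurlingDensity r Λ = 0 := by
    refine (tendsto_of_tendsto_of_tendsto_of_le_of_le' tendsto_const_nhds hlim
      (Eventually.of_forall fun h => bot_le) ?_).limsup_eq
    filter_upwards [hscale.eventually hmass, eventually_gt_atTop 0] with h hm hh
    refine iSup_le fun t => ?_
    have hρ : 0 < (1 / (8 * h)) ^ s := by positivity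
    have h1 := hcount x t h hh (hρ.trans hm)
    have hhr : 0 < h ^ (r : ℝ) := by positivity
    rw [ENNReal.ofReal_rpow_of_pos hh]
    calc ((Λ ∩ Metric.ball t h).encard : ℝ≥0∞) / ENNReal.ofReal (h ^ (r : ℝ))
        ≤ ENNReal.ofReal (B / (1 / (8 * h)) ^ s) / ENNReal.ofReal (h ^ (r : ℝ)) := by
          gcongr
          exact h1.trans (ENNReal.ofReal_le_ofReal (by gcongr))
      _ = ENNReal.ofReal (B / (1 / (8 * h)) ^ s / h ^ (r : ℝ)) :=
          (ENNReal.ofReal_div_of_pos hhr).symm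
      _ = ENNReal.ofReal (B * 8 ^ s * h ^ (-((r : ℝ) - s))) := by
          congr 1
          rw [one_div, Real.inv_rpow (by positivity), Real.mul_rpow (by norm_num) hh.le, neg_sub,
            Real.rpow_sub hh]
          field_simp
  exact hdens.ne' hzero

end Frame

theorem mainTheorem10 (β : ℝ) (hβ : IsPisot β)
    (μ : Measure ℝ) [IsFiniteMeasure μ] (hμ : μ ≠ 0) (hsupp : μ (Set.Icc 0 1)ᶜ = 0)
    (hinv : MeasurePreserving (betaMap β) μ μ)
    (Λ : Set ℝ) (hΛ : IsFrameSpectrum μ Λ) :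
    (∀ᵐ x ∂μ, ∃ δ : ℝ, HasLocalDim μ x δ ∧ beurlingDim Λ ≤ ENNReal.ofReal δ) ∧
    (∀ δ : ℝ, IsExactDimensional μ δ → beurlingDim Λ ≤ ENNReal.ofReal δ) ∧
    (Ergodic (betaMap β) μ →
      ∃ δ : ℝ, IsExactDimensional μ δ ∧ beurlingDim Λ ≤ ENNReal.ofReal δ) := by
  have hexact : ∀ δ : ℝ, IsExactDimensional μ δ → beurlingDim Λ ≤ ENNReal.ofReal δ := by
    intro δ hδ
    have : (ae μ).NeBot := ae_neBot.mpr hμ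
    obtain ⟨x, hx, hsx⟩ := (hδ.and (Measure.support_mem_ae (μ := μ))).exists
    exact beurlingDim_le_of_hasLocalDim hΛ hsx hx
  refine ⟨?_, hexact, fun herg => ?_⟩
  · filter_upwards [ae_exists_hasLocalDim hβ.1 hinv, Measure.support_mem_ae] with x ⟨δ, hδ⟩ hx
    exact ⟨δ, hδ, beurlingDim_le_of_hasLocalDim hΛ hx hδ⟩
  · obtain ⟨δ, hδ⟩ := exists_isExactDimensional_of_ergodic hβ.1 herg
    exact ⟨δ, hδ, hexact δ hδ⟩
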